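/- **Proposition 5.7.** Let $\mathcal{Q}$ be a quasi-abelian category, that is, an additive category in which every morphism has a kernel and a cokernel, every pullback of a cokernel along an arbitrary morphism is again a cokernel, and every pushout of a kernel along an arbitrary morphism is again a kernel. A torsion pair in $\mathcal{Q}$ is a pair $(\mathcal{T},\mathcal{F})$ of full subcategories of $\mathcal{Q}$ such that $\mathrm{Hom}_{\mathcal{Q}}(T,F)=0$ for all $T\in\mathcal{T}$ and $F\in\mathcal{F}$, and such that for every object $M$ of $\mathcal{Q}$ there is a short exact sequence $0\to M'\xrightarrow{i} M\xrightarrow{p} M''\to 0$ in $\mathcal{Q}$ (meaning that $i$ is a kernel of $p$ and $p$ is a cokernel of $i$) with $M'\in\mathcal{T}$ and $M''\in\mathcal{F}$; then $\mathcal{T}$ is called a torsion class and $\mathcal{F}$ a torsionfree class. Every torsion class in $\mathcal{Q}$ and every torsionfree class in $\mathcal{Q}$, as a full subcategory with the additive structure on morphisms inherited from $\mathcal{Q}$, is itself a quasi-abelian category. -/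

import Mathlib

universe v u

open CategoryTheory CategoryTheory.Limits

namespace TorsionQuasiAbelian

section

variable (C : Type u) [Category.{v} C] [Preadditive C]

/-- An additive category: a preadditive category with a zero object, binary products and
binary coproducts. -/
class IsAdditive : Prop where
  hasZeroObject : HasZeroObject C
  hasBinaryProducts : HasBinaryProducts C
  hasBinaryCoproducts : HasBinaryCoproducts C

/-- A pre-abelian category: an additive category in which every morphism has a kernel and a
cokernel. -/
class IsPreAbelian : Prop extends IsAdditive C where
  hasKernels : HasKernels C
  hasCokernels : HasCokernels C

/-- The morphisms that are a kernel of some morphism. -/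
def kernels : MorphismProperty C := fun _ _ f => Nonempty (NormalMono f)

/-- The morphisms that are a cokernel of some morphism. -/
def cokernels : MorphismProperty C := fun _ _ f => Nonempty (NormalEpi f)

/-- A quasi-abelian category: a pre-abelian category in which cokernels are stable under
pullback and kernels are stable under pushout (along arbitrary morphisms). -/
class IsQuasiAbelian : Prop extends IsPreAbelian C where
  cokernels_stable : (cokernels C).IsStableUnderBaseChange
  kernels_stable : (kernels C).IsStableUnderCobaseChange

end

section

variable {C : Type u} [Category.{v} C] [Preadditive C]

/-- `0 ⟶ S.X₁ ⟶ S.X₂ ⟶ S.X₃ ⟶ 0` is a short exact sequence: the first map is a kernel of the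
second, and the second is a cokernel of the first. (In a category that is not abelian this is
stronger than `CategoryTheory.ShortComplex.ShortExact`.) -/
structure IsShortExactSequence (S : ShortComplex C) : Prop where
  isKernel : Nonempty (IsLimit (KernelFork.ofι S.f S.zero))
  isCokernel : Nonempty (IsColimit (CokernelCofork.ofπ S.g S.zero))

/-- A torsion pair of full subcategories, each given by the property that selects its objects. -/
structure IsTorsionPair (T F : ObjectProperty C) : Prop where
  hom_eq_zero : ∀ ⦃X Y : C⦄, T X → F Y → ∀ f : X ⟶ Y, f = 0
  exists_canonical_sequence : ∀ M : C, ∃ (M₁ M₂ : C) (i : M₁ ⟶ M) (p : M ⟶ M₂) (w : i ≫ p = 0),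
    IsShortExactSequence (ShortComplex.mk i p w) ∧ T M₁ ∧ F M₂

/-- A torsion class: the first member of a torsion pair. -/
def IsTorsionClass (T : ObjectProperty C) : Prop := ∃ F : ObjectProperty C, IsTorsionPair T F

/-- A torsionfree class: the second member of a torsion pair. -/
def IsTorsionFreeClass (F : ObjectProperty C) : Prop := ∃ T : ObjectProperty C, IsTorsionPair T F

end

end TorsionQuasiAbelian

/-!
The proof treats a torsion class `𝒯` through a fully faithful additive functor `J : D ⥤ Q` whose
image plays the role of `𝒯`; the torsionfree case is then the torsion case for the opposite
inclusion `Dᵒᵖ ⥤ Qᵒᵖ`, because being quasi-abelian is a self-dual property.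

The canonical sequences `J d ⟶ M ⟶ M''` show that `D` is coreflective in `Q`. Hence `D` inherits
finite limits and finite colimits from `Q`, and `J` preserves colimits. Moreover an object of `Q`
with no nonzero map to a torsionfree object is isomorphic to an object of `D`.

Kernels are stable under pushout in `D`: a kernel in `D` of a map `f` is the composite of the
canonical inclusion `J d ⟶ ker f` with `ker f ⟶ X`, where the kernel is taken in `Q`. Kernels in a
quasi-abelian category compose, so the kernels of `D` are exactly the maps of `D` that are kernels
in `Q`, and `J` preserves pushouts.

Cokernels are stable under pullback in `D`: let `f : X ⟶ Y` be a cokernel in `D`, hence in `Q`, and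
`K` its kernel in `Q`. The composite `J d ⟶ K ⟶ X` is a kernel in `Q`, and its cokernel is still
`f`, since any map from `D` to `K` factors through `J d`. So this composite is also a kernel of `f`,
and `K` is torsion. The pullback `P ⟶ Z` of `f` in `Q` is a cokernel with the same torsion kernel
`K`, so `P` is an extension of torsion objects, hence torsion; therefore `P` is also the pullback
in `D`, and `P ⟶ Z` is the cokernel in `D` of `K ⟶ P`.
-/

namespace TorsionQuasiAbelian

section KernelsAndCokernels

/-! ### Kernels and cokernels by their elementary universal property -/

variable {C : Type*} [Category* C] [Preadditive C]

/-- `i` is a kernel of `p`: it is a monomorphism killed by `p` through which every morphism killed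
by `p` factors. -/
structure IsKernelOf {A X B : C} (i : A ⟶ X) (p : X ⟶ B) : Prop where
  w : i ≫ p = 0
  mono : Mono i
  exists_lift : ∀ {W : C} (x : W ⟶ X), x ≫ p = 0 → ∃ y : W ⟶ A, y ≫ i = x

/-- `p` is a cokernel of `i`: it is an epimorphism killing `i` through which every morphism killing
`i` factors. -/
structure IsCokernelOf {A X B : C} (p : X ⟶ B) (i : A ⟶ X) : Prop where
  w : i ≫ p = 0
  epi : Epi p
  exists_desc : ∀ {W : C} (x : X ⟶ W), i ≫ x = 0 → ∃ y : B ⟶ W, p ≫ y = x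

variable {A X B : C}

lemma IsKernelOf.of_isLimit {i : A ⟶ X} {p : X ⟶ B} (w : i ≫ p = 0)
    (h : IsLimit (KernelFork.ofι i w)) : IsKernelOf i p where
  w := w
  mono := mono_of_isLimit_fork h
  exists_lift x hx := ⟨_, (KernelFork.IsLimit.lift' h x hx).2⟩

lemma IsCokernelOf.of_isColimit {i : A ⟶ X} {p : X ⟶ B} (w : i ≫ p = 0)
    (h : IsColimit (CokernelCofork.ofπ p w)) : IsCokernelOf p i where
  w := w
  epi := epi_of_isColimit_cofork h
  exists_desc x hx := ⟨_, (CokernelCofork.IsColimit.desc' h x hx).2⟩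

lemma isKernelOf_kernel_ι [HasKernels C] (f : X ⟶ B) : IsKernelOf (kernel.ι f) f :=
  .of_isLimit (kernel.condition f) (kernelIsKernel f)

lemma isCokernelOf_cokernel_π [HasCokernels C] (f : A ⟶ X) : IsCokernelOf (cokernel.π f) f :=
  .of_isColimit (cokernel.condition f) (cokernelIsCokernel f)

lemma kernels_iff {i : A ⟶ X} : kernels C i ↔ ∃ (B : C) (p : X ⟶ B), IsKernelOf i p := by
  constructor
  · rintro ⟨h⟩
    exact ⟨_, _, .of_isLimit h.w h.isLimit⟩
  · rintro ⟨B, p, h⟩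
    have := h.mono
    exact ⟨⟨B, p, h.w, KernelFork.IsLimit.ofι' i h.w fun x hx =>
      ⟨(h.exists_lift x hx).choose, (h.exists_lift x hx).choose_spec⟩⟩⟩

lemma cokernels_iff {p : X ⟶ B} : cokernels C p ↔ ∃ (A : C) (i : A ⟶ X), IsCokernelOf p i := by
  constructor
  · rintro ⟨h⟩
    exact ⟨_, _, .of_isColimit h.w h.isColimit⟩
  · rintro ⟨A, i, h⟩
    have := h.epi
    exact ⟨⟨A, i, h.w, CokernelCofork.IsColimit.ofπ' p h.w fun x hx =>
      ⟨(h.exists_desc x hx).choose, (h.exists_desc x hx).choose_spec⟩⟩⟩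

/-- A kernel is a kernel of its cokernel. -/
lemma IsKernelOf.of_isCokernelOf {B' : C} {i : A ⟶ X} {p : X ⟶ B} {q : X ⟶ B'}
    (hp : IsKernelOf i p) (hq : IsCokernelOf q i) : IsKernelOf i q where
  w := hq.w
  mono := hp.mono
  exists_lift x hx := by
    obtain ⟨r, rfl⟩ := hq.exists_desc p hp.w
    exact hp.exists_lift x (by rw [← Category.assoc, hx, zero_comp])

/-- A cokernel is a cokernel of its kernel. -/
lemma IsCokernelOf.of_isKernelOf {A' : C} {i : A ⟶ X} {p : X ⟶ B} {j : A' ⟶ X}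
    (hp : IsCokernelOf p i) (hj : IsKernelOf j p) : IsCokernelOf p j where
  w := hj.w
  epi := hp.epi
  exists_desc x hx := by
    obtain ⟨r, rfl⟩ := hj.exists_lift i hp.w
    exact hp.exists_desc x (by rw [Category.assoc, hx, comp_zero])

lemma IsKernelOf.iso_comp {A' : C} {i : A ⟶ X} {p : X ⟶ B} (h : IsKernelOf i p) (e : A' ≅ A) :
    IsKernelOf (e.hom ≫ i) p where
  w := by rw [Category.assoc, h.w, comp_zero]
  mono := have := h.mono; inferInstance
  exists_lift x hx := by
    obtain ⟨y, rfl⟩ := h.exists_lift x hx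
    exact ⟨y ≫ e.inv, by simp⟩

lemma IsCokernelOf.iso_comp {X' : C} {i : A ⟶ X} {p : X ⟶ B} (h : IsCokernelOf p i)
    (e : X' ≅ X) : IsCokernelOf (e.hom ≫ p) (i ≫ e.inv) where
  w := by simp [h.w]
  epi := have := h.epi; inferInstance
  exists_desc x hx := by
    obtain ⟨y, hy⟩ := h.exists_desc (e.inv ≫ x) (by rw [← Category.assoc, hx])
    exact ⟨y, by simp [hy]⟩

lemma IsKernelOf.op {i : A ⟶ X} {p : X ⟶ B} (h : IsKernelOf i p) : IsCokernelOf i.op p.op where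
  w := by rw [← op_comp, h.w, op_zero]
  epi := have := h.mono; inferInstance
  exists_desc x hx := by
    obtain ⟨y, hy⟩ := h.exists_lift x.unop (Quiver.Hom.op_inj hx)
    exact ⟨y.op, Quiver.Hom.unop_inj hy⟩

lemma IsCokernelOf.op {i : A ⟶ X} {p : X ⟶ B} (h : IsCokernelOf p i) : IsKernelOf p.op i.op where
  w := by rw [← op_comp, h.w, op_zero]
  mono := have := h.epi; inferInstance
  exists_lift x hx := by
    obtain ⟨y, hy⟩ := h.exists_desc x.unop (Quiver.Hom.op_inj hx)
    exact ⟨y.op, Quiver.Hom.unop_inj hy⟩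

lemma IsKernelOf.unop {A X B : Cᵒᵖ} {i : A ⟶ X} {p : X ⟶ B} (h : IsKernelOf i p) :
    IsCokernelOf i.unop p.unop where
  w := by rw [← unop_comp, h.w, unop_zero]
  epi := have := h.mono; inferInstance
  exists_desc x hx := by
    obtain ⟨y, hy⟩ := h.exists_lift x.op (Quiver.Hom.unop_inj hx)
    exact ⟨y.unop, Quiver.Hom.op_inj hy⟩

lemma IsCokernelOf.unop {A X B : Cᵒᵖ} {i : A ⟶ X} {p : X ⟶ B} (h : IsCokernelOf p i) :
    IsKernelOf p.unop i.unop where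
  w := by rw [← unop_comp, h.w, unop_zero]
  mono := have := h.epi; inferInstance
  exists_lift x hx := by
    obtain ⟨y, hy⟩ := h.exists_desc x.op (Quiver.Hom.unop_inj hx)
    exact ⟨y.unop, Quiver.Hom.op_inj hy⟩

end KernelsAndCokernels

section QuasiAbelian

/-! ### Quasi-abelian categories and duality -/

variable (C : Type*) [Category* C] [Preadditive C]

lemma IsPreAbelian.hasFiniteLimits [h : IsPreAbelian C] : HasFiniteLimits C := by
  have := h.hasZeroObject
  have := h.hasBinaryProducts
  have := h.hasKernels
  have := Preadditive.hasEqualizers_of_hasKernels (C := C)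
  have : HasFiniteProducts C := hasFiniteProducts_of_has_binary_and_terminal
  exact hasFiniteLimits_of_hasEqualizers_and_finite_products

lemma IsPreAbelian.hasFiniteColimits [h : IsPreAbelian C] : HasFiniteColimits C := by
  have := h.hasZeroObject
  have := h.hasBinaryCoproducts
  have := h.hasCokernels
  have := Preadditive.hasCoequalizers_of_hasCokernels (C := C)
  have : HasFiniteCoproducts C := hasFiniteCoproducts_of_has_binary_and_initial
  exact hasFiniteColimits_of_hasCoequalizers_and_finite_coproducts

lemma isPreAbelian_of_hasFiniteLimits [HasFiniteLimits C] [HasFiniteColimits C] :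
    IsPreAbelian C where
  hasZeroObject := hasZeroObject_of_hasTerminal_object
  hasBinaryProducts := inferInstance
  hasBinaryCoproducts := inferInstance
  hasKernels := inferInstance
  hasCokernels := inferInstance

lemma kernels_op : kernels Cᵒᵖ = (cokernels C).op := by
  ext X Y f
  rw [MorphismProperty.op, kernels_iff, cokernels_iff]
  exact ⟨fun ⟨_, _, h⟩ => ⟨_, _, h.unop⟩, fun ⟨_, _, h⟩ => ⟨_, _, h.op⟩⟩

lemma cokernels_op : cokernels Cᵒᵖ = (kernels C).op := by
  ext X Y f
  rw [MorphismProperty.op, kernels_iff, cokernels_iff]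
  exact ⟨fun ⟨_, _, h⟩ => ⟨_, _, h.unop⟩, fun ⟨_, _, h⟩ => ⟨_, _, h.op⟩⟩

lemma IsQuasiAbelian.op [IsQuasiAbelian C] : IsQuasiAbelian Cᵒᵖ := by
  have := IsPreAbelian.hasFiniteLimits C
  have := IsPreAbelian.hasFiniteColimits C
  have := IsQuasiAbelian.cokernels_stable (C := C)
  have := IsQuasiAbelian.kernels_stable (C := C)
  exact
    { isPreAbelian_of_hasFiniteLimits Cᵒᵖ with
      cokernels_stable := by rw [cokernels_op]; infer_instance
      kernels_stable := by rw [kernels_op]; infer_instance }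

lemma IsQuasiAbelian.of_op [IsQuasiAbelian Cᵒᵖ] : IsQuasiAbelian C := by
  have : HasFiniteLimits C :=
    hasFiniteColimits_opposite_iff.1 (IsPreAbelian.hasFiniteColimits Cᵒᵖ)
  have : HasFiniteColimits C :=
    hasFiniteLimits_opposite_iff.1 (IsPreAbelian.hasFiniteLimits Cᵒᵖ)
  have h₁ := IsQuasiAbelian.cokernels_stable (C := Cᵒᵖ)
  have h₂ := IsQuasiAbelian.kernels_stable (C := Cᵒᵖ)
  rw [cokernels_op] at h₁
  rw [kernels_op] at h₂
  exact
    { isPreAbelian_of_hasFiniteLimits C with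
      cokernels_stable := inferInstanceAs (cokernels C).op.unop.IsStableUnderBaseChange
      kernels_stable := inferInstanceAs (kernels C).op.unop.IsStableUnderCobaseChange }

variable {C}

/-- In a quasi-abelian category kernels are closed under composition. -/
lemma kernels_comp [IsQuasiAbelian C] {A B X : C} {i : A ⟶ B} {j : B ⟶ X} (hi : kernels C i)
    (hj : kernels C j) : kernels C (i ≫ j) := by
  have := IsPreAbelian.hasFiniteColimits C
  have := IsQuasiAbelian.kernels_stable (C := C)
  obtain ⟨D, p, hp⟩ := kernels_iff.1 hi
  obtain ⟨E, q, hq⟩ := kernels_iff.1 hj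
  have sq := IsPushout.of_hasPushout p j
  obtain ⟨_, _, h⟩ := kernels_iff.1 (MorphismProperty.of_isPushout sq hj)
  -- The composite is a kernel of the pushout `X ⟶ D ⨿_B X` of `p` along `j`.
  refine kernels_iff.2 ⟨_, pushout.inr p j, ?_, ?_, fun x hx => ?_⟩
  · rw [Category.assoc, ← pushout.condition, reassoc_of% hp.w, zero_comp]
  · have := hp.mono
    have := hq.mono
    infer_instance
  · obtain ⟨y, rfl⟩ := hq.exists_lift x (by
      rw [← pushout.inr_desc (f := p) (g := j) 0 q (by rw [hq.w, comp_zero]),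
        reassoc_of% hx, zero_comp])
    have := h.mono
    obtain ⟨z, rfl⟩ := hp.exists_lift y (by
      rw [← cancel_mono (pushout.inl p j), Category.assoc, pushout.condition,
        ← Category.assoc, hx, zero_comp])
    exact ⟨z, by simp⟩

end QuasiAbelian

section TorsionInclusion

/-! ### Torsion classes as coreflective subcategories -/

variable {D Q : Type*} [Category* D] [Category* Q] [Preadditive D] [Preadditive Q]

/-- The functor `J` exhibits `D` as the torsion class of a torsion pair in `Q` with torsionfree
class `F`. Working with a functor instead of a full subcategory makes the notion dualizable without
leaving opposite categories for equivalent ones. -/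
structure IsTorsionInclusion (J : D ⥤ Q) (F : ObjectProperty Q) : Prop where
  full : J.Full
  faithful : J.Faithful
  additive : J.Additive
  hom_eq_zero : ∀ {d : D} {Y : Q}, F Y → ∀ f : J.obj d ⟶ Y, f = 0
  exists_sequence : ∀ M : Q, ∃ (d : D) (M₂ : Q) (i : J.obj d ⟶ M) (p : M ⟶ M₂),
    IsKernelOf i p ∧ IsCokernelOf p i ∧ F M₂

namespace IsTorsionInclusion

variable {J : D ⥤ Q} {F : ObjectProperty Q}

lemma isLeftAdjoint (hJ : IsTorsionInclusion J F) : J.IsLeftAdjoint := by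
  have := hJ.full
  have := hJ.faithful
  rw [isLeftAdjoint_iff_hasTerminal_costructuredArrow]
  intro M
  obtain ⟨d, M₂, i, p, hi, -, hF⟩ := hJ.exists_sequence M
  have := hi.mono
  have lift (x : CostructuredArrow J M) : ∃ y : x.left ⟶ d, J.map y ≫ i = x.hom := by
    obtain ⟨y, hy⟩ := hi.exists_lift x.hom (hJ.hom_eq_zero hF _)
    exact ⟨J.preimage y, by simpa using hy⟩
  refine (IsTerminal.ofUniqueHom (Y := CostructuredArrow.mk i)
    (fun x => CostructuredArrow.homMk (lift x).choose (lift x).choose_spec)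
    fun x y => ?_).hasTerminal
  ext
  apply J.map_injective
  rw [← cancel_mono i]
  exact (CostructuredArrow.w y).trans (lift x).choose_spec.symm

/-- The functor is a coreflective inclusion: the coreflection of an object is the torsion part of
its canonical sequence. -/
noncomputable abbrev coreflective (hJ : IsTorsionInclusion J F) : Coreflective J :=
  { hJ.full, hJ.faithful with
    R := have := hJ.isLeftAdjoint; J.rightAdjoint
    adj := have := hJ.isLeftAdjoint; Adjunction.ofIsLeftAdjoint J }

/-- An object without nonzero maps to torsionfree objects is torsion. -/
lemma exists_iso (hJ : IsTorsionInclusion J F) {M : Q}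
    (hM : ∀ {Y : Q}, F Y → ∀ f : M ⟶ Y, f = 0) : ∃ d : D, Nonempty (J.obj d ≅ M) := by
  obtain ⟨d, M₂, i, p, hi, -, hF⟩ := hJ.exists_sequence M
  have := hi.mono
  obtain ⟨s, hs⟩ := hi.exists_lift (𝟙 M) (hM hF _)
  exact ⟨d, ⟨⟨i, s, by rw [← cancel_mono i, Category.assoc, hs]; simp, hs⟩⟩⟩

section

variable {X Y Z : D} {f : X ⟶ Y} {g : Y ⟶ Z}

lemma isKernelOf_of_map (hJ : IsTorsionInclusion J F) (h : IsKernelOf (J.map f) (J.map g)) :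
    IsKernelOf f g := by
  have := hJ.full
  have := hJ.faithful
  have := hJ.additive
  refine ⟨J.map_injective (by simpa using h.w), J.mono_of_mono_map h.mono, fun x hx => ?_⟩
  obtain ⟨y, hy⟩ := h.exists_lift (J.map x) (by rw [← J.map_comp, hx, J.map_zero])
  exact ⟨J.preimage y, J.map_injective (by simpa using hy)⟩

lemma isCokernelOf_of_map (hJ : IsTorsionInclusion J F) (h : IsCokernelOf (J.map g) (J.map f)) :
    IsCokernelOf g f := by
  have := hJ.full
  have := hJ.faithful
  have := hJ.additive
  refine ⟨J.map_injective (by simpa using h.w), J.epi_of_epi_map h.epi, fun x hx => ?_⟩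
  obtain ⟨y, hy⟩ := h.exists_desc (J.map x) (by rw [← J.map_comp, hx, J.map_zero])
  exact ⟨J.preimage y, J.map_injective (by simpa using hy)⟩

lemma map_isCokernelOf (hJ : IsTorsionInclusion J F) (h : IsCokernelOf g f) :
    IsCokernelOf (J.map g) (J.map f) := by
  have := hJ.additive
  have := hJ.isLeftAdjoint
  have := h.epi
  have adj := Adjunction.ofIsLeftAdjoint J
  refine ⟨by rw [← J.map_comp, h.w, J.map_zero], inferInstance, fun {W} x hx => ?_⟩
  obtain ⟨y, hy⟩ := h.exists_desc (adj.homEquiv _ _ x) (by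
    rw [← adj.homEquiv_naturality_left, hx, adj.homEquiv_unit, Functor.map_zero, comp_zero])
  exact ⟨(adj.homEquiv _ _).symm y, by
    rw [← adj.homEquiv_naturality_left_symm, hy, Equiv.symm_apply_apply]⟩

end

variable [IsQuasiAbelian Q]

lemma isPreAbelian (hJ : IsTorsionInclusion J F) : IsPreAbelian D := by
  have := IsPreAbelian.hasFiniteLimits Q
  have := IsPreAbelian.hasFiniteColimits Q
  have := hJ.coreflective
  have : HasFiniteLimits D := ⟨fun _ _ _ => hasLimitsOfShape_of_coreflective J⟩
  have : HasFiniteColimits D := ⟨fun _ _ _ => hasColimitsOfShape_of_coreflective J⟩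
  exact isPreAbelian_of_hasFiniteLimits D

/-- Kernels in a torsion class are kernels in the ambient quasi-abelian category. -/
lemma map_kernels (hJ : IsTorsionInclusion J F) {X Y : D} {f : X ⟶ Y} (hf : kernels D f) :
    kernels Q (J.map f) := by
  have := hJ.full
  have := hJ.faithful
  have := hJ.additive
  have := IsPreAbelian.hasKernels (C := Q)
  obtain ⟨Z, p, hp⟩ := kernels_iff.1 hf
  have hκ := isKernelOf_kernel_ι (J.map p)
  obtain ⟨d, M₂, i, q, hi, -, hF⟩ := hJ.exists_sequence (kernel (J.map p))
  obtain ⟨E, r, hr⟩ := kernels_iff.1 (kernels_comp (kernels_iff.2 ⟨_, _, hi⟩)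
    (kernels_iff.2 ⟨_, _, hκ⟩))
  -- Both `f` and `m` are kernels of `p` in `D`, so `J.map f` is a kernel because `J.map m` is one.
  obtain ⟨m, hm⟩ := J.map_surjective (i ≫ kernel.ι (J.map p))
  rw [← hm] at hr
  obtain ⟨y, hy⟩ := hκ.exists_lift (J.map f) (by rw [← J.map_comp, hp.w, J.map_zero])
  obtain ⟨z, rfl⟩ := hi.exists_lift y (hJ.hom_eq_zero hF _)
  obtain ⟨z, rfl⟩ := J.map_surjective z
  obtain ⟨w, hw⟩ := hp.exists_lift m (J.map_injective (by
    rw [J.map_comp, hm, Category.assoc, hκ.w, comp_zero, J.map_zero]))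
  have hz : z ≫ m = f := J.map_injective (by rw [J.map_comp, hm, ← hy, Category.assoc])
  have := J.mono_of_mono_map hr.mono
  have := hp.mono
  let e : X ≅ d := ⟨z, w, by rw [← cancel_mono f]; simp [hw, hz],
    by rw [← cancel_mono m]; simp [hw, hz]⟩
  have h := hr.iso_comp (J.mapIso e)
  rw [Functor.mapIso_hom, ← J.map_comp, hz] at h
  exact kernels_iff.2 ⟨_, _, h⟩

/-- The kernel of a cokernel between torsion objects is torsion as soon as it is a cokernel in the
torsion class. -/
lemma exists_isKernelOf_map (hJ : IsTorsionInclusion J F) {X Y : D} {f : X ⟶ Y}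
    (hf : cokernels D f) : ∃ (d : D) (m : d ⟶ X), IsKernelOf (J.map m) (J.map f) := by
  have := hJ.full
  have := IsPreAbelian.hasKernels (C := Q)
  obtain ⟨W, g, hg⟩ := cokernels_iff.1 hf
  replace hg := hJ.map_isCokernelOf hg
  have hκ := isKernelOf_kernel_ι (J.map f)
  obtain ⟨d, M₂, i, q, hi, -, hF⟩ := hJ.exists_sequence (kernel (J.map f))
  obtain ⟨E, r, hr⟩ := kernels_iff.1 (kernels_comp (kernels_iff.2 ⟨_, _, hi⟩)
    (kernels_iff.2 ⟨_, _, hκ⟩))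
  obtain ⟨m, hm⟩ := J.map_surjective (i ≫ kernel.ι (J.map f))
  refine ⟨d, m, ?_⟩
  rw [hm]
  refine hr.of_isCokernelOf ⟨by rw [Category.assoc, hκ.w, comp_zero], hg.epi, fun x hx => ?_⟩
  -- The map `J.map g`, whose source is torsion, factors through the torsion part of the kernel.
  obtain ⟨u, hu⟩ := hκ.exists_lift (J.map g) hg.w
  obtain ⟨v, rfl⟩ := hi.exists_lift u (hJ.hom_eq_zero hF _)
  exact hg.exists_desc x (by rw [← hu, Category.assoc, Category.assoc, ← Category.assoc i, hx,
    comp_zero])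

lemma kernels_isStableUnderCobaseChange (hJ : IsTorsionInclusion J F) :
    (kernels D).IsStableUnderCobaseChange where
  of_isPushout {A A' B B' f g f' g'} sq hf := by
    have := hJ.isLeftAdjoint
    have := hJ.isPreAbelian.hasCokernels
    have := IsQuasiAbelian.kernels_stable (C := Q)
    obtain ⟨_, _, h⟩ := kernels_iff.1
      (MorphismProperty.of_isPushout (sq.map J) (hJ.map_kernels hf))
    exact kernels_iff.2 ⟨_, _, hJ.isKernelOf_of_map
      (h.of_isCokernelOf (hJ.map_isCokernelOf (isCokernelOf_cokernel_π f')))⟩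

lemma cokernels_isStableUnderBaseChange (hJ : IsTorsionInclusion J F) :
    (cokernels D).IsStableUnderBaseChange where
  of_isPullback {X Y Y' S f g f' g'} sq hg := by
    have := hJ.full
    have := hJ.faithful
    have := IsPreAbelian.hasFiniteLimits Q
    have := IsQuasiAbelian.cokernels_stable (C := Q)
    obtain ⟨d, m, hm⟩ := hJ.exists_isKernelOf_map hg
    obtain ⟨W, c, hc⟩ := cokernels_iff.1 hg
    have sqQ := IsPullback.of_hasPullback (J.map g) (J.map f)
    obtain ⟨_, _, hp⟩ := cokernels_iff.1 (MorphismProperty.of_isPullback sqQ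
      (cokernels_iff.2 ⟨_, _, hJ.map_isCokernelOf hc⟩))
    -- The pullback in `Q` is a cokernel with the same torsion kernel `J.obj d` as `J.map g`.
    obtain ⟨k, hk₁, hk₂⟩ := sqQ.exists_lift (J.map m) 0 (by rw [hm.w, zero_comp])
    have hk : IsKernelOf k (pullback.snd (J.map g) (J.map f)) := by
      have := hm.mono
      refine ⟨hk₂, mono_of_mono_fac hk₁, fun x hx => ?_⟩
      obtain ⟨y, hy⟩ := hm.exists_lift (x ≫ pullback.fst (J.map g) (J.map f)) (by
        rw [Category.assoc, pullback.condition, reassoc_of% hx, zero_comp])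
      exact ⟨y, sqQ.hom_ext (by rw [Category.assoc, hk₁, hy])
        (by rw [Category.assoc, hk₂, comp_zero, hx])⟩
    replace hp := hp.of_isKernelOf hk
    -- It is therefore an extension of torsion objects, hence torsion.
    obtain ⟨P, ⟨e⟩⟩ := hJ.exists_iso (M := pullback (J.map g) (J.map f)) (fun hY x => by
      obtain ⟨y, rfl⟩ := hp.exists_desc x (hJ.hom_eq_zero hY _)
      rw [hJ.hom_eq_zero hY y, comp_zero])
    obtain ⟨a, ha⟩ := J.map_surjective (e.hom ≫ pullback.fst _ _)
    obtain ⟨b, hb⟩ := J.map_surjective (e.hom ≫ pullback.snd _ _)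
    obtain ⟨n, hn⟩ := J.map_surjective (k ≫ e.inv)
    have hJsq : IsPullback (J.map a) (J.map b) (J.map g) (J.map f) :=
      .of_iso_pullback ⟨by rw [ha, hb, Category.assoc, Category.assoc, pullback.condition]⟩ e
        ha.symm hb.symm
    replace hp := hp.iso_comp e
    rw [← hb, ← hn] at hp
    have h := (hJ.isCokernelOf_of_map hp).iso_comp
      (sq.isoIsPullback _ _ (hJsq.of_map_of_faithful J))
    rw [IsPullback.isoIsPullback_hom_snd] at h
    exact cokernels_iff.2 ⟨_, _, h⟩

lemma isQuasiAbelian (hJ : IsTorsionInclusion J F) : IsQuasiAbelian D :=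
  { hJ.isPreAbelian with
    cokernels_stable := hJ.cokernels_isStableUnderBaseChange
    kernels_stable := hJ.kernels_isStableUnderCobaseChange }

end IsTorsionInclusion

end TorsionInclusion

section TorsionPair

/-! ### The two classes of a torsion pair -/

variable {Q : Type*} [Category* Q] [Preadditive Q] {T F : ObjectProperty Q}

lemma IsShortExactSequence.isKernelOf {S : ShortComplex Q} (h : IsShortExactSequence S) :
    IsKernelOf S.f S.g :=
  .of_isLimit S.zero h.isKernel.some

lemma IsShortExactSequence.isCokernelOf {S : ShortComplex Q} (h : IsShortExactSequence S) :
    IsCokernelOf S.g S.f :=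
  .of_isColimit S.zero h.isCokernel.some

lemma IsTorsionPair.isTorsionInclusion (h : IsTorsionPair T F) : IsTorsionInclusion T.ι F where
  full := inferInstance
  faithful := inferInstance
  additive := inferInstance
  hom_eq_zero {d _} hY f := h.hom_eq_zero d.property hY f
  exists_sequence M := by
    obtain ⟨M₁, M₂, i, p, w, hS, h₁, h₂⟩ := h.exists_canonical_sequence M
    exact ⟨⟨M₁, h₁⟩, M₂, i, p, hS.isKernelOf, hS.isCokernelOf, h₂⟩

/-- The opposite of the torsionfree class of a torsion pair is a torsion class in the opposite
category. -/
lemma IsTorsionPair.isTorsionInclusion_op (h : IsTorsionPair T F) :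
    IsTorsionInclusion F.ι.op T.op where
  full := inferInstance
  faithful := inferInstance
  additive := inferInstance
  hom_eq_zero {d _} hY f := Quiver.Hom.unop_inj (h.hom_eq_zero hY d.unop.property f.unop)
  exists_sequence M := by
    obtain ⟨M₁, M₂, i, p, w, hS, h₁, h₂⟩ := h.exists_canonical_sequence M.unop
    exact ⟨.op ⟨M₂, h₂⟩, .op M₁, p.op, i.op, hS.isCokernelOf.op, hS.isKernelOf.op, h₁⟩

end TorsionPair

end TorsionQuasiAbelian

theorem proposition5p7 {Q : Type u} [Category.{v} Q] [Preadditive Q]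
    [TorsionQuasiAbelian.IsQuasiAbelian Q] :
    (∀ T : ObjectProperty Q, TorsionQuasiAbelian.IsTorsionClass T →
      TorsionQuasiAbelian.IsQuasiAbelian T.FullSubcategory) ∧
    (∀ F : ObjectProperty Q, TorsionQuasiAbelian.IsTorsionFreeClass F →
      TorsionQuasiAbelian.IsQuasiAbelian F.FullSubcategory) := by
  refine ⟨fun T ⟨F, h⟩ => h.isTorsionInclusion.isQuasiAbelian, fun F ⟨T, h⟩ => ?_⟩
  have := TorsionQuasiAbelian.IsQuasiAbelian.op Q
  have := h.isTorsionInclusion_op.isQuasiAbelian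
  exact TorsionQuasiAbelian.IsQuasiAbelian.of_op _
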